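/- Let $m,s\ge 1$ and $r,t$ be integers with $r^s\equiv 1 \pmod m$ and $m\mid t(r-1)$, and let $$G=\langle a,b \mid a^m=1,\ b^s=a^t,\ b^{-1}ab=a^r\rangle$$ be the corresponding finite metacyclic group. For a set $\mathcal F$ of subgroups of a group $G$ that generates $G$ and is closed under conjugation (writing $x^h=h^{-1}xh$ and $F^h=h^{-1}Fh$), the *active sum* $S$ of $\mathcal F$ is the quotient of the free product of the members of $\mathcal F$ by the normal subgroup generated by all elements $h^{-1}\cdot g\cdot h\cdot (g^h)^{-1}$ with $h\in F_1$, $g\in F_2$, $F_1,F_2\in\mathcal F$, where $g^h$ is taken in the free factor $F_2^h\in\mathcal F$. The inclusions $F\le G$ induce a canonical homomorphism $\varphi:S\to G$, and $G$ *is the active sum of* $\mathcal F$ if $\varphi$ is an isomorphism. **Theorem.** If $\gcd(m,r-1)$ divides $t$, then $G$ is the active sum of the set $\mathcal F$ of subgroups consisting of $\langle a\rangle$, $\langle b\rangle$ and the conjugates of $\langle b\rangle$ in $G$. That is, $\mathcal F$ generates $G$, is closed under conjugation, and the canonical homomorphism from its active sum to $G$ is an isomorphism. -/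

import Mathlib

/-- The conjugate `F^g = g⁻¹ F g` of a subgroup. -/
def Subgroup.rightConj {G : Type*} [Group G] (F : Subgroup G) (g : G) : Subgroup G :=
  F.map (MulAut.conj g⁻¹).toMonoidHom

namespace ActiveSum

variable {G : Type*} [Group G]

/-- The free product of the (distinct) members of a set `𝓕` of subgroups of `G`. -/
abbrev FreeProd (𝓕 : Set (Subgroup G)) : Type _ :=
  Monoid.CoprodI (fun F : 𝓕 => (F : Subgroup G))

/-- The inclusion of a member of the family in the free product. -/
abbrev incl {𝓕 : Set (Subgroup G)} (F : 𝓕) : (F : Subgroup G) →* FreeProd 𝓕 :=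
  Monoid.CoprodI.of (M := fun F : 𝓕 => (F : Subgroup G)) (i := F)

/-- The elements `h⁻¹ · g · h · (g^h)⁻¹` of the free product, for `h ∈ F₁`, `g ∈ F₂`, where
`g^h = h⁻¹ g h` (here `k`) is taken in the member `F₃ = F₂^h` of the family. -/
def relators (𝓕 : Set (Subgroup G)) : Set (FreeProd 𝓕) :=
  {x | ∃ (F₁ F₂ F₃ : 𝓕) (h : (F₁ : Subgroup G)) (g : (F₂ : Subgroup G)) (k : (F₃ : Subgroup G)),
    (F₃ : Subgroup G) = (F₂ : Subgroup G).rightConj (h : G) ∧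
    (k : G) = (h : G)⁻¹ * (g : G) * (h : G) ∧
    x = (incl F₁ h)⁻¹ * incl F₂ g * incl F₁ h * (incl F₃ k)⁻¹}

end ActiveSum

/-- The active sum of a discrete family of distinct subgroups of `G`. -/
abbrev ActiveSum {G : Type*} [Group G] (𝓕 : Set (Subgroup G)) : Type _ :=
  ActiveSum.FreeProd 𝓕 ⧸ Subgroup.normalClosure (ActiveSum.relators 𝓕)

namespace ActiveSum

variable {G : Type*} [Group G]

/-- The homomorphism from the free product to `G` induced by the inclusions `F ≤ G`. -/
def freeProdHom (𝓕 : Set (Subgroup G)) : FreeProd 𝓕 →* G :=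
  Monoid.CoprodI.lift (fun F : 𝓕 => (F : Subgroup G).subtype)

theorem normalClosure_relators_le_ker (𝓕 : Set (Subgroup G)) :
    Subgroup.normalClosure (relators 𝓕) ≤ (freeProdHom 𝓕).ker := by
  apply Subgroup.normalClosure_le_normal
  rintro x ⟨F₁, F₂, F₃, h, g, k, -, hk, rfl⟩
  simp [freeProdHom, MonoidHom.mem_ker, hk]

/-- The canonical homomorphism `φ : S → G` from the active sum to `G`. -/
def toGroup (𝓕 : Set (Subgroup G)) : ActiveSum 𝓕 →* G :=
  QuotientGroup.lift _ (freeProdHom 𝓕) (normalClosure_relators_le_ker 𝓕)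

end ActiveSum

/-- `G` is the active sum of the family `𝓕` of subgroups: the family is generating, closed under
conjugation, and the canonical homomorphism from its active sum to `G` is an isomorphism. -/
structure IsActiveSum {G : Type*} [Group G] (𝓕 : Set (Subgroup G)) : Prop where
  generating : sSup 𝓕 = ⊤
  conj_mem : ∀ F ∈ 𝓕, ∀ g : G, F.rightConj g ∈ 𝓕
  bijective : Function.Bijective (ActiveSum.toGroup 𝓕)

/-- The relators of `⟨a, b | a^m = 1, b^s = a^t, b⁻¹ a b = a^r⟩`; `a` is the generator `0` and
`b` is the generator `1`. -/
def metacyclicRelators (m s : ℕ) (t r : ℤ) : Set (FreeGroup (Fin 2)) :=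
  let a := FreeGroup.of (0 : Fin 2)
  let b := FreeGroup.of (1 : Fin 2)
  {a ^ m, b ^ s * (a ^ t)⁻¹, b⁻¹ * a * b * (a ^ r)⁻¹}

/-- The group `⟨a, b | a^m = 1, b^s = a^t, b⁻¹ a b = a^r⟩`. -/
abbrev MetacyclicGroup (m s : ℕ) (t r : ℤ) : Type :=
  PresentedGroup (metacyclicRelators m s t r)

namespace MetacyclicGroup

/-- The generator `a`. -/
def a (m s : ℕ) (t r : ℤ) : MetacyclicGroup m s t r := PresentedGroup.of 0

/-- The generator `b`. -/
def b (m s : ℕ) (t r : ℤ) : MetacyclicGroup m s t r := PresentedGroup.of 1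

/-- The set of subgroups consisting of `⟨a⟩`, `⟨b⟩` and the conjugates of `⟨b⟩`. -/
def family (m s : ℕ) (t r : ℤ) : Set (Subgroup (MetacyclicGroup m s t r)) :=
  {Subgroup.zpowers (a m s t r), Subgroup.zpowers (b m s t r)} ∪
    {F | ∃ g, F = (Subgroup.zpowers (b m s t r)).rightConj g}

end MetacyclicGroup

/-!
Let `S` be the active sum of the family, `φ : S → G` the canonical map, and let `α, β ∈ S` be the
images of `a ∈ ⟨a⟩` and `b ∈ ⟨b⟩`. An inverse `ψ : G → S` of `φ` with `a ↦ α`, `b ↦ β` exists as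
soon as `α` and `β` satisfy the defining relations of `G`. The relation `α ^ m = 1` is clear, and
`β⁻¹ α β = α ^ r` is a relator of the active sum because `⟨a⟩` is normalised by `b`. The point is
`β ^ s = α ^ t`, since `b ^ s = a ^ t` relates elements of two, in general different, free factors.

By Bézout, `gcd(m, r - 1) ∣ t` gives `v` with `a ^ t = a ^ (v (r - 1))`. In `G` this means
`a⁻ᵛ b aᵛ = b a ^ (-v (r - 1)) = b a⁻ᵗ = b ^ (1 - s)`, so that `a ^ v` normalises `⟨b⟩`. Hence the
factor `⟨b⟩ ^ (a ^ v)` is the factor `⟨b⟩` itself, and the active sum has the relation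
`α⁻ᵛ β αᵛ = β ^ (1 - s)` (`ActiveSum.conj_ι`). On the other hand `β⁻¹ α β = α ^ r` alone gives
`α⁻ᵛ β αᵛ = β α⁻ᵗ`. Comparing the two yields `β ^ s = α ^ t`.

Finally `ψ` and `φ` are mutually inverse. For `ψ ∘ φ` one uses that conjugation by any `y ∈ S` moves
the factor `F` to the factor `F ^ φ(y)` the way `φ(y)` does in `G` (`ActiveSum.conj_ι_of_toGroup`),
so `ψ` agrees with the canonical embedding on every conjugate of `⟨b⟩`.
-/

/-! ### Conjugates of subgroups and powers of elements -/

theorem Subgroup.mem_rightConj {G : Type*} [Group G] {F : Subgroup G} {g x : G} :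
    x ∈ F.rightConj g ↔ ∃ y ∈ F, g⁻¹ * y * g = x := by
  simp [Subgroup.rightConj, Subgroup.mem_map]

theorem Subgroup.rightConj_one {G : Type*} [Group G] (F : Subgroup G) : F.rightConj 1 = F := by
  ext x
  simp [Subgroup.mem_rightConj]

theorem Subgroup.rightConj_mul {G : Type*} [Group G] (F : Subgroup G) (g h : G) :
    F.rightConj (g * h) = (F.rightConj g).rightConj h := by
  ext x
  simp [Subgroup.mem_rightConj, mul_assoc]

theorem Subgroup.rightConj_zpowers {G : Type*} [Group G] (x g : G) :
    (Subgroup.zpowers x).rightConj g = Subgroup.zpowers (g⁻¹ * x * g) := by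
  simp [Subgroup.rightConj, MonoidHom.map_zpowers]

/-- If `x⁻¹ y x = y ^ r`, then `y⁻ᵛ x yᵛ = x y ^ (-v (r - 1))`. -/
theorem zpow_inv_mul_mul_zpow_of_conj {G : Type*} [Group G] {x y : G} {r : ℤ}
    (h : x⁻¹ * y * x = y ^ r) (v : ℤ) :
    (y ^ v)⁻¹ * x * y ^ v = x * (y ^ (v * (r - 1)))⁻¹ := by
  have h1 : x⁻¹ * y ^ (-v) * x = y ^ (r * -v) := by
    rw [zpow_mul, ← h]
    simpa using (conj_zpow (i := -v) (a := x⁻¹) (b := y)).symm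
  have h2 : y ^ (-v) * x = x * y ^ (r * -v) := by
    rw [← h1]; group
  rw [← zpow_neg, h2, mul_assoc, ← zpow_add, ← zpow_neg]
  congr 2; ring

/-- Bézout: an exponent divisible by `gcd(m, k)` may be replaced, on elements of exponent `m`, by a
multiple of `k`. -/
theorem exists_zpow_eq_zpow_mul_of_gcd_dvd {m : ℕ} {k t : ℤ} (h : (Int.gcd (m : ℤ) k : ℤ) ∣ t) :
    ∃ v : ℤ, ∀ {G : Type} [Group G] (x : G), x ^ m = 1 → x ^ t = x ^ (v * k) := by
  obtain ⟨c, rfl⟩ := h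
  refine ⟨Int.gcdB m k * c, fun {G} _ x hx => ?_⟩
  have : (Int.gcd (m : ℤ) k : ℤ) * c = m * (Int.gcdA m k * c) + Int.gcdB m k * c * k := by
    rw [Int.gcd_eq_gcd_ab]; ring
  rw [this, zpow_add, zpow_mul, zpow_natCast, hx, one_zpow, one_mul]

/-! ### Conjugation in an active sum -/

namespace ActiveSum

section

variable {G : Type*} [Group G] {𝓕 : Set (Subgroup G)}

/-- The canonical homomorphism from a member of the family to the active sum. -/
def ι (F : 𝓕) : (F : Subgroup G) →* ActiveSum 𝓕 :=
  (QuotientGroup.mk' (Subgroup.normalClosure (relators 𝓕))).comp (incl F)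

theorem toGroup_ι (F : 𝓕) (x : (F : Subgroup G)) : toGroup 𝓕 (ι F x) = x := by
  simp [toGroup, ι, freeProdHom]

theorem conj_ι (F₁ F₂ F₃ : 𝓕) (h : (F₁ : Subgroup G)) (g : (F₂ : Subgroup G))
    (k : (F₃ : Subgroup G)) (hF : (F₃ : Subgroup G) = (F₂ : Subgroup G).rightConj (h : G))
    (hk : (k : G) = (h : G)⁻¹ * (g : G) * (h : G)) :
    (ι F₁ h)⁻¹ * ι F₂ g * ι F₁ h = ι F₃ k := by
  rw [← mul_inv_eq_one]
  exact (QuotientGroup.eq_one_iff _).2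
    (Subgroup.subset_normalClosure ⟨F₁, F₂, F₃, h, g, k, hF, hk, rfl⟩)

theorem hom_ext {H : Type*} [Monoid H] {f g : ActiveSum 𝓕 →* H}
    (h : ∀ (F : 𝓕) (x : (F : Subgroup G)), f (ι F x) = g (ι F x)) : f = g :=
  QuotientGroup.monoidHom_ext _ (Monoid.CoprodI.ext_hom _ _ fun F => MonoidHom.ext (h F))

theorem induction_on {p : ActiveSum 𝓕 → Prop} (y : ActiveSum 𝓕) (one : p 1)
    (of : ∀ (F : 𝓕) (x : (F : Subgroup G)), p (ι F x)) (mul : ∀ y z, p y → p z → p (y * z)) :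
    p y := by
  obtain ⟨w, rfl⟩ := QuotientGroup.mk'_surjective _ y
  induction w using Monoid.CoprodI.induction_on with
  | one => simpa using one
  | of F x => exact of F x
  | mul x y hx hy => rw [map_mul]; exact mul _ _ hx hy

/-- Conjugation by `y` in the active sum permutes the factors, and acts on their elements, the way
conjugation by the image of `y` does in `G`. -/
theorem conj_ι_of_toGroup (hconj : ∀ F ∈ 𝓕, ∀ g : G, F.rightConj g ∈ 𝓕) (y : ActiveSum 𝓕) :
    ∀ (F F' : 𝓕) (x : (F : Subgroup G)) (x' : (F' : Subgroup G)),
      (F' : Subgroup G) = (F : Subgroup G).rightConj (toGroup 𝓕 y) →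
      (x' : G) = (toGroup 𝓕 y)⁻¹ * x * toGroup 𝓕 y → y⁻¹ * ι F x * y = ι F' x' := by
  induction y using induction_on with
  | one =>
    intro F F' x x' hF hx
    obtain rfl : F' = F := Subtype.ext (by simpa [Subgroup.rightConj_one] using hF)
    obtain rfl : x' = x := Subtype.ext (by simpa using hx)
    simp
  | of E h =>
    intro F F' x x' hF hx
    rw [toGroup_ι] at hF hx
    exact conj_ι E F F' h x x' hF hx
  | mul y z hy hz =>
    intro F F' x x' hF hx
    rw [map_mul] at hF hx
    have h1 := hy F ⟨_, hconj F F.2 (toGroup 𝓕 y)⟩ x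
      ⟨(toGroup 𝓕 y)⁻¹ * x * toGroup 𝓕 y, Subgroup.mem_rightConj.2 ⟨x, x.2, rfl⟩⟩ rfl rfl
    have h2 := hz ⟨_, hconj F F.2 (toGroup 𝓕 y)⟩ F'
      ⟨(toGroup 𝓕 y)⁻¹ * x * toGroup 𝓕 y, Subgroup.mem_rightConj.2 ⟨x, x.2, rfl⟩⟩ x'
      (hF.trans (Subgroup.rightConj_mul _ _ _))
      (hx.trans (by simp only [mul_inv_rev, mul_assoc]))
    rw [← h2, ← h1]
    group

end

end ActiveSum

/-! ### Subgroups of a metacyclic group -/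

namespace MetacyclicGroup

variable {m s : ℕ} {t r : ℤ}

theorem a_pow : a m s t r ^ m = 1 :=
  PresentedGroup.one_of_mem (rels := metacyclicRelators m s t r) (by simp [metacyclicRelators])

theorem b_pow : b m s t r ^ s = a m s t r ^ t :=
  mul_inv_eq_one.1 <|
    PresentedGroup.one_of_mem (rels := metacyclicRelators m s t r) (by simp [metacyclicRelators])

theorem conj_a : (b m s t r)⁻¹ * a m s t r * b m s t r = a m s t r ^ r :=
  mul_inv_eq_one.1 <|
    PresentedGroup.one_of_mem (rels := metacyclicRelators m s t r) (by simp [metacyclicRelators])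

/-- The homomorphism from the metacyclic group given by two elements satisfying its relations. -/
def lift {H : Type*} [Group H] (x y : H) (hx : x ^ m = 1) (hy : y ^ s = x ^ t)
    (hxy : y⁻¹ * x * y = x ^ r) : MetacyclicGroup m s t r →* H :=
  PresentedGroup.toGroup (f := ![x, y]) (by
    rintro w (rfl | rfl | rfl) <;> simp [hx, hy, hxy])

section

variable {H : Type*} [Group H] {x y : H} (hx : x ^ m = 1) (hy : y ^ s = x ^ t)
  (hxy : y⁻¹ * x * y = x ^ r)

theorem lift_a : lift x y hx hy hxy (a m s t r) = x := PresentedGroup.toGroup.of _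

theorem lift_b : lift x y hx hy hxy (b m s t r) = y := PresentedGroup.toGroup.of _

end

theorem hom_ext {H : Type*} [Group H] {f g : MetacyclicGroup m s t r →* H}
    (ha : f (a m s t r) = g (a m s t r)) (hb : f (b m s t r) = g (b m s t r)) : f = g :=
  PresentedGroup.ext (rels := metacyclicRelators m s t r) (φ := f) (ψ := g)
    (Fin.forall_fin_two.2 ⟨ha, hb⟩)

theorem sSup_family : sSup (family m s t r) = ⊤ := by
  rw [eq_top_iff, ← PresentedGroup.closure_range_of, Subgroup.closure_le]
  rintro _ ⟨i, rfl⟩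
  fin_cases i
  · exact le_sSup (a := Subgroup.zpowers (a m s t r)) (by simp [family])
      (Subgroup.mem_zpowers (a m s t r))
  · exact le_sSup (a := Subgroup.zpowers (b m s t r)) (by simp [family])
      (Subgroup.mem_zpowers (b m s t r))

theorem a_zpow_zpow (hs : 0 < s) (hrs : r ^ s ≡ 1 [ZMOD (m : ℤ)]) :
    (a m s t r ^ r) ^ (r ^ (s - 1)) = a m s t r := by
  obtain ⟨c, hc⟩ := hrs.symm.dvd
  have h1 : r * r ^ (s - 1) = m * c + 1 := by
    rw [mul_pow_sub_one hs.ne']; linarith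
  rw [← zpow_mul, h1, zpow_add, zpow_mul, zpow_natCast, a_pow, one_zpow, one_mul, zpow_one]

theorem rightConj_zpowers_a (hs : 0 < s) (hrs : r ^ s ≡ 1 [ZMOD (m : ℤ)])
    (g : MetacyclicGroup m s t r) :
    (Subgroup.zpowers (a m s t r)).rightConj g = Subgroup.zpowers (a m s t r) := by
  have hg : g ∈ Subgroup.closure
      (Set.range (PresentedGroup.of (rels := metacyclicRelators m s t r))) := by
    rw [PresentedGroup.closure_range_of]; trivial
  induction hg using Subgroup.closure_induction with
  | mem x hx =>
    obtain ⟨i, rfl⟩ := hx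
    rw [Subgroup.rightConj_zpowers]
    fin_cases i
    · change Subgroup.zpowers ((a m s t r)⁻¹ * a m s t r * a m s t r) = _
      simp
    · change Subgroup.zpowers ((b m s t r)⁻¹ * a m s t r * b m s t r) = _
      rw [conj_a]
      -- `a ^ r` generates `⟨a⟩` because `r` is invertible modulo `m`
      exact le_antisymm (Subgroup.zpowers_le.2 (Subgroup.zpow_mem_zpowers _ _))
        (Subgroup.zpowers_le.2 ⟨_, a_zpow_zpow hs hrs⟩)
  | one => exact Subgroup.rightConj_one _
  | mul x y _ _ hx hy => rw [Subgroup.rightConj_mul, hx, hy]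
  | inv x _ hx =>
    conv_lhs => rw [← hx]
    rw [← Subgroup.rightConj_mul, mul_inv_cancel, Subgroup.rightConj_one]

theorem rightConj_mem_family (hs : 0 < s) (hrs : r ^ s ≡ 1 [ZMOD (m : ℤ)]) :
    ∀ F ∈ family m s t r, ∀ g, F.rightConj g ∈ family m s t r := by
  rintro F ((rfl | rfl) | ⟨h, rfl⟩) g
  · exact Or.inl (Or.inl (rightConj_zpowers_a hs hrs g))
  · exact Or.inr ⟨g, rfl⟩
  · exact Or.inr ⟨h * g, (Subgroup.rightConj_mul _ _ _).symm⟩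

/-- If `a ^ t = a ^ (v (r - 1))`, then `a ^ v` conjugates `b` to `b ^ (1 - s)`. -/
theorem conj_b {v : ℤ} (hv : a m s t r ^ t = a m s t r ^ (v * (r - 1))) :
    (a m s t r ^ v)⁻¹ * b m s t r * a m s t r ^ v = b m s t r ^ (1 - s : ℤ) := by
  rw [zpow_inv_mul_mul_zpow_of_conj conj_a, ← hv, ← b_pow, zpow_sub, zpow_one, zpow_natCast]

/-- If `a ^ t = a ^ (v (r - 1))`, then `a ^ v` normalises `⟨b⟩`. -/
theorem rightConj_zpowers_b {v : ℤ} (hv : a m s t r ^ t = a m s t r ^ (v * (r - 1))) :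
    (Subgroup.zpowers (b m s t r)).rightConj (a m s t r ^ v) = Subgroup.zpowers (b m s t r) := by
  refine le_antisymm ?_ (Subgroup.zpowers_le.2 (Subgroup.mem_rightConj.2 ?_))
  · rw [Subgroup.rightConj_zpowers, conj_b hv]
    exact Subgroup.zpowers_le.2 (Subgroup.zpow_mem_zpowers _ _)
  -- `b ^ s = a ^ t` commutes with `a ^ v`, so `b ^ (1 + s)` is conjugated to
  -- `b ^ (1 - s) * b ^ s = b`
  · refine ⟨b m s t r * b m s t r ^ s,
      mul_mem (Subgroup.mem_zpowers _) (Subgroup.npow_mem_zpowers _ _), ?_⟩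
    have h1 : b m s t r ^ s * a m s t r ^ v = a m s t r ^ v * b m s t r ^ s := by
      rw [b_pow, ← zpow_add, ← zpow_add, add_comm]
    rw [mul_assoc, mul_assoc, h1, ← mul_assoc, ← mul_assoc, conj_b hv, ← zpow_natCast, ← zpow_add]
    simp

/-! ### The active sum of a metacyclic group -/

section

variable (m s t r)

/-- The member `⟨a⟩` of the family. -/
def factorA : family m s t r := ⟨Subgroup.zpowers (a m s t r), Or.inl (Or.inl rfl)⟩

/-- The member `⟨b⟩` of the family. -/
def factorB : family m s t r := ⟨Subgroup.zpowers (b m s t r), Or.inl (Or.inr rfl)⟩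

/-- The image in the active sum of `a`, taken in the factor `⟨a⟩`. -/
def α : ActiveSum (family m s t r) :=
  ActiveSum.ι (factorA m s t r) ⟨a m s t r, Subgroup.mem_zpowers _⟩

/-- The image in the active sum of `b`, taken in the factor `⟨b⟩`. -/
def β : ActiveSum (family m s t r) :=
  ActiveSum.ι (factorB m s t r) ⟨b m s t r, Subgroup.mem_zpowers _⟩

end

theorem ι_factorA_zpow (k : ℤ) :
    ActiveSum.ι (factorA m s t r) ⟨a m s t r ^ k, Subgroup.zpow_mem_zpowers _ _⟩ =
      α m s t r ^ k := by
  rw [α, ← map_zpow]; rfl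

theorem ι_factorB_zpow (k : ℤ) :
    ActiveSum.ι (factorB m s t r) ⟨b m s t r ^ k, Subgroup.zpow_mem_zpowers _ _⟩ =
      β m s t r ^ k := by
  rw [β, ← map_zpow]; rfl

theorem α_pow : α m s t r ^ m = 1 := by
  rw [α, ← map_pow, ← map_one (ActiveSum.ι (factorA m s t r))]
  exact congrArg _ (Subtype.ext a_pow)

theorem conj_α (hs : 0 < s) (hrs : r ^ s ≡ 1 [ZMOD (m : ℤ)]) :
    (β m s t r)⁻¹ * α m s t r * β m s t r = α m s t r ^ r := by
  rw [← ι_factorA_zpow]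
  exact ActiveSum.conj_ι _ _ _ _ _ _ (rightConj_zpowers_a hs hrs _).symm conj_a.symm

/-- The relation `b ^ s = a ^ t` holds in the active sum: the conjugate of `β` by `α ^ v` is
`β * α ^ (-t)` by the relation between `α` and `β`, and `β ^ (1 - s)` because `a ^ v` normalises
`⟨b⟩`. -/
theorem β_pow (hs : 0 < s) (hrs : r ^ s ≡ 1 [ZMOD (m : ℤ)])
    (h : (Int.gcd (m : ℤ) (r - 1) : ℤ) ∣ t) : β m s t r ^ s = α m s t r ^ t := by
  obtain ⟨v, hv⟩ := exists_zpow_eq_zpow_mul_of_gcd_dvd h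
  have hva := hv _ (a_pow (m := m) (s := s) (t := t) (r := r))
  have h1 : (α m s t r ^ v)⁻¹ * β m s t r * α m s t r ^ v = β m s t r ^ (1 - s : ℤ) := by
    rw [← ι_factorA_zpow, ← ι_factorB_zpow]
    exact ActiveSum.conj_ι _ _ _ _ _ _ (rightConj_zpowers_b hva).symm (conj_b hva).symm
  rw [zpow_inv_mul_mul_zpow_of_conj (conj_α hs hrs), ← hv _ α_pow, zpow_sub, zpow_one,
    zpow_natCast] at h1
  exact (inv_injective (mul_left_cancel h1)).symm

theorem bijective_toGroup (hs : 0 < s) (hrs : r ^ s ≡ 1 [ZMOD (m : ℤ)])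
    (h : (Int.gcd (m : ℤ) (r - 1) : ℤ) ∣ t) :
    Function.Bijective (ActiveSum.toGroup (family m s t r)) := by
  let ψ : MetacyclicGroup m s t r →* ActiveSum (family m s t r) :=
    lift (α m s t r) (β m s t r) α_pow (β_pow hs hrs h) (conj_α hs hrs)
  have hψa : ψ (a m s t r) = α m s t r := lift_a _ _ _
  have hψb : ψ (b m s t r) = β m s t r := lift_b _ _ _
  have h1 : (ActiveSum.toGroup (family m s t r)).comp ψ = MonoidHom.id _ := by
    apply hom_ext
    · rw [MonoidHom.comp_apply, hψa]; exact ActiveSum.toGroup_ι _ _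
    · rw [MonoidHom.comp_apply, hψb]; exact ActiveSum.toGroup_ι _ _
  have h1' (g) : ActiveSum.toGroup (family m s t r) (ψ g) = g := DFunLike.congr_fun h1 g
  have h2 : ψ.comp (ActiveSum.toGroup (family m s t r)) = MonoidHom.id _ := by
    refine ActiveSum.hom_ext ?_
    rintro ⟨F, hF⟩ ⟨x, hx⟩
    rw [MonoidHom.comp_apply, ActiveSum.toGroup_ι, MonoidHom.id_apply]
    obtain (rfl | rfl) | ⟨g, rfl⟩ := hF
    · obtain ⟨k, rfl⟩ := hx
      exact (map_zpow ψ _ k).trans (hψa ▸ (ι_factorA_zpow k).symm)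
    · obtain ⟨k, rfl⟩ := hx
      exact (map_zpow ψ _ k).trans (hψb ▸ (ι_factorB_zpow k).symm)
    · obtain ⟨_, ⟨k, rfl⟩, rfl⟩ := Subgroup.mem_rightConj.1 hx
      rw [← ActiveSum.conj_ι_of_toGroup (rightConj_mem_family hs hrs) (ψ g) (factorB m s t r) _
        ⟨b m s t r ^ k, Subgroup.zpow_mem_zpowers _ _⟩ ⟨_, hx⟩ (by rw [h1']; rfl) (by rw [h1'])]
      simp only [map_mul, map_inv, map_zpow, ι_factorB_zpow, hψb]
  exact Function.bijective_iff_has_inverse.2 ⟨ψ, DFunLike.congr_fun h2, h1'⟩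

end MetacyclicGroup

theorem mainTheorem3 (m s : ℕ) (t r : ℤ) (hm : 0 < m) (hs : 0 < s)
    (hrs : r ^ s ≡ 1 [ZMOD (m : ℤ)]) (htr : (m : ℤ) ∣ t * (r - 1))
    (h : (Int.gcd (m : ℤ) (r - 1) : ℤ) ∣ t) :
    IsActiveSum (MetacyclicGroup.family m s t r) :=
  ⟨MetacyclicGroup.sSup_family, MetacyclicGroup.rightConj_mem_family hs hrs,
    MetacyclicGroup.bijective_toGroup hs hrs h⟩
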